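/- Let $\Omega_n=\{0,1\}^n$ carry the uniform probability measure and the coordinatewise order, and call an event $\mathcal A\subset\Omega_n$ monotone if its indicator function $\chi_{\mathcal A}$ is nondecreasing. For $f:\Omega_n\to\mathbb R$ let $I_j(f)=\mathbf E\,|f(\sigma_jx)-f(x)|$, where $\sigma_j$ flips the $j$-th bit, let $I\!I(f)=\sum_{j=1}^n I_j(f)^2$, and for $S\subset\{1,\dots,n\}$ let $\hat f(S)=\mathbf E\big[f(x)(-1)^{\sum_{j\in S}x_j}\big]$; write $I\!I(\mathcal A)=I\!I(\chi_{\mathcal A})$. Theorem. For each $k=1,2,\dots$ there is a constant $C_k<\infty$ such that for every $n$ and every monotone event $\mathcal A\subset\Omega_n$, with $f=\chi_{\mathcal A}$, $$\sum_{|S|=k}\hat f(S)^2\le C_k\,I\!I(\mathcal A)\,\bigl(1-\log I\!I(\mathcal A)\bigr)^{k-1},$$ and moreover, if $k\le 2$ or $I\!I(\mathcal A)\le 1/2$, then $$\sum_{|S|=k}\hat f(S)^2\le C_k\,I\!I(\mathcal A)\,\bigl(-\log I\!I(\mathcal A)\bigr)^{k-1}.$$ (When $I\!I(\mathcal A)=0$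 the right-hand sides are read as $0$.) -/

import Mathlib

open scoped BigOperators

noncomputable section

/-- The discrete cube `{0,1}^n`, with the coordinatewise order (`false < true`). -/
abbrev Cube (n : ℕ) : Type := Fin n → Bool

/-- Expectation with respect to the uniform probability measure on the cube. -/
def cubeExp {n : ℕ} (f : Cube n → ℝ) : ℝ :=
  (∑ x : Cube n, f x) / 2 ^ n

/-- `flipBit j x` is `x` with its `j`-th coordinate flipped. -/
def flipBit {n : ℕ} (j : Fin n) (x : Cube n) : Cube n :=
  Function.update x j (!(x j))

/-- The influence of the `j`-th variable: `I_j(f) = E |f(σ_j x) - f(x)|`. -/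
def influence {n : ℕ} (f : Cube n → ℝ) (j : Fin n) : ℝ :=
  cubeExp fun x => |f (flipBit j x) - f x|

/-- The sum of the squared influences, `II(f) = ∑_j I_j(f)^2`. -/
def sumSqInfluence {n : ℕ} (f : Cube n → ℝ) : ℝ :=
  ∑ j : Fin n, influence f j ^ 2

/-- The character `u_S(x) = (-1)^{|{j ∈ S : x_j = 1}|}`. -/
def walsh {n : ℕ} (S : Finset (Fin n)) (x : Cube n) : ℝ :=
  (-1) ^ (S.filter fun j => x j = true).card

/-- The Fourier-Walsh coefficient of `f` at `S`: the expectation `E (f u_S)`. -/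
def fourierWalsh {n : ℕ} (f : Cube n → ℝ) (S : Finset (Fin n)) : ℝ :=
  cubeExp fun x => f x * walsh S x

/-- The Fourier weight of `f` on level `k`: the sum of squared coefficients over `|S| = k`. -/
def levelWeight {n : ℕ} (k : ℕ) (f : Cube n → ℝ) : ℝ :=
  ∑ S ∈ (Finset.univ : Finset (Fin n)).powersetCard k, fourierWalsh f S ^ 2

/-- The indicator function of an event. -/
def eventInd {n : ℕ} (A : Set (Cube n)) : Cube n → ℝ :=
  A.indicator fun _ => 1

/-- An event is monotone if its indicator function is monotone. -/
def MonotoneEvent {n : ℕ} (A : Set (Cube n)) : Prop :=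
  Monotone (eventInd A)

end

/-!
Let `f` be the indicator of a monotone event and fix a set `J` of coordinates. For `j ∉ J`, fixing
the coordinates in `J` leaves a monotone function of the others; let `H j` be its coefficient at
`{j}`, which depends on the fixed coordinates. Three facts about `H` carry the proof.

* Its Walsh coefficients are `fourierWalsh f (insert j T)` for `T ⊆ J`
  (`fourierWalsh_fourierWalsh_piecewise`), so every coefficient of `f` at a set with exactly one
  element outside `J` is a coefficient of some `H j`.
* By Bessel's inequality `∑ j, H j x ^ 2 ≤ 1` for every `x`.
* By monotonicity `H j ≤ 0`, so that `E |H j| = |E H j| = I_j(f) / 2`.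

It remains to bound the level-`d` weight, `d = k - 1`, of a map `H` into the unit ball of `ℓ²` in
terms of a bound `δ` for `4 ∑ (E |H j|)²` (`sum_sq_fourierWalsh_level_le`).
If `L j` is the level-`d` part of `H j`, with variance `v j`, then this weight is `V = ∑ v j = ∑ E (H j * L j)`. Where
`|L j| ≤ t √(v j)`, the contribution is at most `t √(V δ)`; elsewhere it is at most the `L²` norm
of the tails of the `L j`, because `H` is in the unit ball. By hypercontractivity in the moment
`2(m + 1)` with `m` about `log (1 / δ)` (`cubeExp_walshSum_powersetCard_pow_le`), `t ^ 2` of order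
`m ^ d` makes the tails negligible, and `V = O(m ^ d δ)`. Averaging over `J` yields the bound for
the whole level (`levelWeight_succ_le_of_forall`).

When `k = 2` and `I = sumSqInfluence f` is close to one, the sharper form follows from the fact that
the weights of levels one and two add up to at most the variance of `f`, the former being `I / 4`.
-/

noncomputable section

/-! ### Expectation on the cube -/

lemma cubeExp_add {n : ℕ} (f g : Cube n → ℝ) :
    cubeExp (fun x => f x + g x) = cubeExp f + cubeExp g := by
  simp only [cubeExp, Finset.sum_add_distrib, add_div]

lemma cubeExp_const_mul {n : ℕ} (c : ℝ) (f : Cube n → ℝ) :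
    cubeExp (fun x => c * f x) = c * cubeExp f := by
  simp only [cubeExp, ← Finset.mul_sum, mul_div_assoc]

lemma cubeExp_neg {n : ℕ} (f : Cube n → ℝ) :
    cubeExp (fun x => -f x) = -cubeExp f := by
  simp only [cubeExp, Finset.sum_neg_distrib, neg_div]

lemma cubeExp_sum {n : ℕ} {ι : Type*} (s : Finset ι) (f : ι → Cube n → ℝ) :
    cubeExp (fun x => ∑ i ∈ s, f i x) = ∑ i ∈ s, cubeExp (f i) := by
  simp only [cubeExp, ← Finset.sum_div]
  rw [Finset.sum_comm]

lemma cubeExp_const {n : ℕ} (c : ℝ) : cubeExp (fun _ : Cube n => c) = c := by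
  simp [cubeExp]

lemma cubeExp_mono {n : ℕ} {f g : Cube n → ℝ} (h : ∀ x, f x ≤ g x) :
    cubeExp f ≤ cubeExp g := by
  unfold cubeExp
  gcongr
  exact h _

lemma cubeExp_nonneg {n : ℕ} {f : Cube n → ℝ} (h : ∀ x, 0 ≤ f x) : 0 ≤ cubeExp f :=
  div_nonneg (Finset.sum_nonneg fun x _ => h x) (by positivity)

lemma eq_zero_of_cubeExp_eq_zero {n : ℕ} {f : Cube n → ℝ} (h : ∀ x, 0 ≤ f x)
    (h0 : cubeExp f = 0) (x : Cube n) : f x = 0 := by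
  have h1 : ∑ x : Cube n, f x = 0 := by
    have h2 : (2 : ℝ) ^ n ≠ 0 := by positivity
    simpa [cubeExp, h2] using h0
  exact (Finset.sum_eq_zero_iff_of_nonneg fun x _ => h x).1 h1 x (Finset.mem_univ x)

lemma flipBit_involutive {n : ℕ} (j : Fin n) : Function.Involutive (flipBit j) := by
  intro x
  simp [flipBit]

lemma cubeExp_comp_flipBit {n : ℕ} (j : Fin n) (f : Cube n → ℝ) :
    cubeExp (fun x => f (flipBit j x)) = cubeExp f := by
  unfold cubeExp
  congr 1
  exact Equiv.sum_comp (flipBit_involutive j).toPerm f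

/-- If `x` and `z` are independent and uniform, then the point that agrees with `x` on `J` and
with `z` off `J` is uniform. -/
lemma cubeExp_cubeExp_piecewise {n : ℕ} (J : Finset (Fin n)) (F : Cube n → ℝ) :
    cubeExp (fun x => cubeExp fun z => F (J.piecewise x z)) = cubeExp F := by
  have hinv : Function.Involutive
      (fun p : Cube n × Cube n => (J.piecewise p.1 p.2, J.piecewise p.2 p.1)) := by
    rintro ⟨x, z⟩
    ext i <;> by_cases hi : i ∈ J <;> simp [hi]
  have h : ∑ x : Cube n, ∑ z : Cube n, F (J.piecewise x z) = 2 ^ n * ∑ x : Cube n, F x := by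
    have h1 := Equiv.sum_comp hinv.toPerm (fun p : Cube n × Cube n => F p.1)
    simp only [Function.Involutive.coe_toPerm, Fintype.sum_prod_type] at h1
    rw [h1]
    simp [Finset.mul_sum]
  simp only [cubeExp, ← Finset.sum_div]
  rw [h]
  field_simp

/-! ### Walsh functions -/

lemma walsh_eq_prod {n : ℕ} (S : Finset (Fin n)) (x : Cube n) :
    walsh S x = ∏ j ∈ S, if x j = true then (-1 : ℝ) else 1 := by
  rw [walsh, Finset.prod_ite]
  simp

lemma walsh_empty {n : ℕ} (x : Cube n) : walsh ∅ x = 1 := by simp [walsh]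

lemma walsh_singleton {n : ℕ} (j : Fin n) (x : Cube n) :
    walsh {j} x = if x j = true then -1 else 1 := by simp [walsh_eq_prod]

lemma walsh_insert {n : ℕ} {j : Fin n} {S : Finset (Fin n)} (hj : j ∉ S) (x : Cube n) :
    walsh (insert j S) x = walsh {j} x * walsh S x := by
  rw [walsh_eq_prod, Finset.prod_insert hj, ← walsh_eq_prod, walsh_singleton]

lemma walsh_congr {n : ℕ} {S : Finset (Fin n)} {x y : Cube n} (h : ∀ j ∈ S, x j = y j) :
    walsh S x = walsh S y := by
  rw [walsh_eq_prod, walsh_eq_prod]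
  exact Finset.prod_congr rfl fun j hj => by rw [h j hj]

lemma walsh_mul_self {n : ℕ} (S : Finset (Fin n)) (x : Cube n) : walsh S x * walsh S x = 1 := by
  rw [walsh, ← mul_pow]
  simp

lemma walsh_flipBit_of_notMem {n : ℕ} {S : Finset (Fin n)} {j : Fin n} (hj : j ∉ S)
    (x : Cube n) : walsh S (flipBit j x) = walsh S x := by
  apply walsh_congr
  intro i hi
  have : i ≠ j := fun h => hj (h ▸ hi)
  simp [flipBit, this]

lemma walsh_flipBit_of_mem {n : ℕ} {S : Finset (Fin n)} {j : Fin n} (hj : j ∈ S)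
    (x : Cube n) : walsh S (flipBit j x) = -walsh S x := by
  rw [← Finset.insert_erase hj, walsh_insert (Finset.notMem_erase j S),
    walsh_insert (Finset.notMem_erase j S), walsh_flipBit_of_notMem (Finset.notMem_erase j S),
    walsh_singleton, walsh_singleton]
  cases h : x j <;> simp [flipBit, h]

lemma cubeExp_eq_zero_of_flipBit {n : ℕ} {f : Cube n → ℝ} (j : Fin n)
    (h : ∀ x, f (flipBit j x) = -f x) : cubeExp f = 0 := by
  have h1 := cubeExp_comp_flipBit j f
  simp only [h, cubeExp_neg] at h1
  linarith

lemma cubeExp_walsh_mul_walsh {n : ℕ} (S T : Finset (Fin n)) :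
    cubeExp (fun x => walsh S x * walsh T x) = if S = T then 1 else 0 := by
  split_ifs with h
  · subst h
    simp only [walsh_mul_self, cubeExp_const]
  · have h' : ∃ j, ¬(j ∈ S ↔ j ∈ T) := by
      by_contra! hc
      exact h (Finset.ext hc)
    obtain ⟨j, hj⟩ := h'
    apply cubeExp_eq_zero_of_flipBit j
    intro x
    by_cases h1 : j ∈ S <;> by_cases h2 : j ∈ T
    · simp [h1, h2] at hj
    · simp [walsh_flipBit_of_mem h1, walsh_flipBit_of_notMem h2]
    · simp [walsh_flipBit_of_notMem h1, walsh_flipBit_of_mem h2]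
    · simp [h1, h2] at hj

/-- Bessel's inequality for the Walsh functions. -/
lemma sum_fourierWalsh_sq_le {n : ℕ} (F : Finset (Finset (Fin n))) (f : Cube n → ℝ) :
    ∑ S ∈ F, fourierWalsh f S ^ 2 ≤ cubeExp fun x => f x ^ 2 := by
  have h0 : 0 ≤ cubeExp fun x => (f x - ∑ S ∈ F, fourierWalsh f S * walsh S x) ^ 2 :=
    cubeExp_nonneg fun x => sq_nonneg _
  have h1 : ∀ x : Cube n, (f x - ∑ S ∈ F, fourierWalsh f S * walsh S x) ^ 2 =
      f x ^ 2 + ((-2) * (∑ S ∈ F, fourierWalsh f S * (f x * walsh S x)) +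
        ∑ S ∈ F, ∑ T ∈ F, fourierWalsh f S * fourierWalsh f T * (walsh S x * walsh T x)) := by
    intro x
    have e1 : ∑ S ∈ F, fourierWalsh f S * (f x * walsh S x) =
        f x * ∑ S ∈ F, fourierWalsh f S * walsh S x := by
      rw [Finset.mul_sum]
      exact Finset.sum_congr rfl fun S _ => by ring
    have e2 : ∑ S ∈ F, ∑ T ∈ F, fourierWalsh f S * fourierWalsh f T * (walsh S x * walsh T x) =
        (∑ S ∈ F, fourierWalsh f S * walsh S x) * ∑ S ∈ F, fourierWalsh f S * walsh S x := by
      rw [Finset.sum_mul_sum]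
      exact Finset.sum_congr rfl fun S _ => Finset.sum_congr rfl fun T _ => by ring
    rw [e1, e2]
    ring
  simp only [h1, cubeExp_add, cubeExp_const_mul, cubeExp_sum, cubeExp_walsh_mul_walsh] at h0
  have e3 : ∀ S, cubeExp (fun x => f x * walsh S x) = fourierWalsh f S := fun S => rfl
  simp only [e3, mul_ite, mul_one, mul_zero, Finset.sum_ite_eq, Finset.sum_ite_mem,
    Finset.inter_self, ← pow_two] at h0
  linarith

/-! ### Influences and monotonicity -/

lemma fourierWalsh_eq_half_diff {n : ℕ} (f : Cube n → ℝ) {S : Finset (Fin n)} {j : Fin n}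
    (hj : j ∈ S) :
    fourierWalsh f S = -cubeExp (fun x => (f (flipBit j x) - f x) * walsh S x) / 2 := by
  have h1 := cubeExp_comp_flipBit j (fun x => f x * walsh S x)
  simp only [walsh_flipBit_of_mem hj] at h1
  have h2 : (fun x => (f (flipBit j x) - f x) * walsh S x) =
      fun x => -(f (flipBit j x) * -walsh S x) + -(f x * walsh S x) := by
    funext x
    ring
  rw [h2, cubeExp_add, cubeExp_neg, cubeExp_neg, h1]
  simp only [fourierWalsh]
  ring

lemma fourierWalsh_singleton_of_monotone {n : ℕ} {f : Cube n → ℝ} (hf : Monotone f)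
    (j : Fin n) : fourierWalsh f {j} = -influence f j / 2 := by
  rw [fourierWalsh_eq_half_diff f (Finset.mem_singleton_self j), influence]
  congr 3
  funext x
  rw [walsh_singleton]
  cases h : x j
  · have : x ≤ flipBit j x := by
      intro i
      by_cases hi : i = j
      · subst hi; simp [h]
      · simp [flipBit, hi]
    simp [abs_of_nonneg (sub_nonneg.2 (hf this))]
  · have : flipBit j x ≤ x := by
      intro i
      by_cases hi : i = j
      · subst hi; simp [h]
      · simp [flipBit, hi]
    simp [abs_of_nonpos (sub_nonpos.2 (hf this))]

lemma influence_nonneg {n : ℕ} (f : Cube n → ℝ) (j : Fin n) : 0 ≤ influence f j :=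
  cubeExp_nonneg fun _ => abs_nonneg _

lemma sumSqInfluence_nonneg {n : ℕ} (f : Cube n → ℝ) : 0 ≤ sumSqInfluence f :=
  Finset.sum_nonneg fun _ _ => sq_nonneg _

lemma sum_powersetCard_one {n : ℕ} (F : Finset (Fin n) → ℝ) :
    ∑ S ∈ (Finset.univ : Finset (Fin n)).powersetCard 1, F S = ∑ j, F {j} := by
  rw [Finset.powersetCard_one, Finset.sum_map]
  rfl

lemma levelWeight_one_of_monotone {n : ℕ} {f : Cube n → ℝ} (hf : Monotone f) :
    levelWeight 1 f = sumSqInfluence f / 4 := by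
  rw [levelWeight, sum_powersetCard_one, sumSqInfluence, Finset.sum_div]
  refine Finset.sum_congr rfl fun j _ => ?_
  rw [fourierWalsh_singleton_of_monotone hf]
  ring

lemma levelWeight_eq_zero_of_sumSqInfluence_eq_zero {n k : ℕ} (hk : 1 ≤ k) {f : Cube n → ℝ}
    (h : sumSqInfluence f = 0) : levelWeight k f = 0 := by
  apply Finset.sum_eq_zero
  intro S hS
  rw [Finset.mem_powersetCard] at hS
  obtain ⟨j, hj⟩ : S.Nonempty := by
    rw [← Finset.card_pos]
    omega
  have h1 : influence f j ^ 2 = 0 :=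
    (Finset.sum_eq_zero_iff_of_nonneg fun _ _ => sq_nonneg _).1 h j (Finset.mem_univ j)
  have h2 := eq_zero_of_cubeExp_eq_zero (fun x => abs_nonneg _) (pow_eq_zero_iff two_ne_zero |>.1 h1)
  have h3 : ∀ x, f (flipBit j x) - f x = 0 := fun x => abs_eq_zero.1 (h2 x)
  rw [fourierWalsh_eq_half_diff f hj]
  simp [h3, cubeExp_const]

/-! ### Hypercontractivity for even moments -/

/-- The ratio of consecutive quotients `(2m choose 2l) / (m choose l)` is
`(2m - 2l - 1) / (2l + 1)`, which is at most `2m - 1`. -/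
lemma choose_two_mul_le (m l : ℕ) :
    ((2 * m).choose (2 * l) : ℝ) ≤ (2 * m - 1 : ℝ) ^ l * (m.choose l : ℝ) := by
  induction l with
  | zero => simp
  | succ l ih =>
    rcases le_or_gt m l with hml | hml
    · rw [Nat.choose_eq_zero_of_lt (by omega : 2 * m < 2 * (l + 1))]
      rw [Nat.choose_eq_zero_of_lt (by omega : m < l + 1)]
      simp
    · obtain ⟨r, rfl⟩ := Nat.exists_eq_add_of_lt hml
      have h1 := Nat.choose_succ_right_eq (2 * (l + r + 1)) (2 * l)
      have h2 := Nat.choose_succ_right_eq (2 * (l + r + 1)) (2 * l + 1)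
      have h3 := Nat.choose_succ_right_eq (l + r + 1) l
      rw [show 2 * (l + r + 1) - 2 * l = 2 * r + 2 by omega] at h1
      rw [show 2 * (l + r + 1) - (2 * l + 1) = 2 * r + 1 by omega] at h2
      rw [show (l + r + 1) - l = r + 1 by omega] at h3
      rw [show 2 * (l + 1) = 2 * l + 1 + 1 by ring]
      have h1' := congrArg (Nat.cast (R := ℝ)) h1
      have h2' := congrArg (Nat.cast (R := ℝ)) h2
      have h3' := congrArg (Nat.cast (R := ℝ)) h3
      push_cast at h1' h2' h3' ih ⊢
      set X : ℝ := ((2 * (l + r + 1)).choose (2 * l) : ℝ)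
      set Y : ℝ := ((2 * (l + r + 1)).choose (2 * l + 1) : ℝ)
      set Z : ℝ := ((2 * (l + r + 1)).choose (2 * l + 1 + 1) : ℝ)
      set U : ℝ := ((l + r + 1).choose l : ℝ)
      set V : ℝ := ((l + r + 1).choose (l + 1) : ℝ)
      set c : ℝ := 2 * ((l : ℝ) + r + 1) - 1 with hc
      have hl : (0 : ℝ) ≤ l := Nat.cast_nonneg l
      have hr : (0 : ℝ) ≤ r := Nat.cast_nonneg r
      have hc0 : 0 ≤ c := by rw [hc]; linarith
      have hX : 0 ≤ X := Nat.cast_nonneg _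
      have hZ : Z * ((2 * l + 1) * (l + 1)) = X * ((2 * r + 1) * (r + 1)) := by
        have : Z * (2 * l + 1 + 1) * (2 * l + 1) = Y * (2 * l + 1) * (2 * r + 1) := by
          rw [h2']; ring
        rw [h1'] at this
        linarith
      have hpos : (0 : ℝ) < (2 * l + 1) * (l + 1) := by positivity
      have key : Z * ((2 * l + 1) * (l + 1)) ≤ c ^ (l + 1) * V * ((2 * l + 1) * (l + 1)) := by
        calc Z * ((2 * l + 1) * (l + 1)) = X * ((2 * r + 1) * (r + 1)) := hZ
          _ ≤ X * ((c * (2 * l + 1)) * (r + 1)) := by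
            gcongr
            rw [hc]
            nlinarith
          _ ≤ (c ^ l * U) * ((c * (2 * l + 1)) * (r + 1)) := by gcongr
          _ = c ^ (l + 1) * (U * (r + 1)) * (2 * l + 1) := by ring
          _ = c ^ (l + 1) * (V * (l + 1)) * (2 * l + 1) := by rw [h3']
          _ = c ^ (l + 1) * V * ((2 * l + 1) * (l + 1)) := by ring
      exact le_of_mul_le_mul_right key hpos

lemma sum_range_two_mul_add_one (F : ℕ → ℝ) (m : ℕ) :
    ∑ i ∈ Finset.range (2 * m + 1), F i =
      ∑ l ∈ Finset.range (m + 1), F (2 * l) + ∑ l ∈ Finset.range m, F (2 * l + 1) := by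
  induction m with
  | zero => simp
  | succ m ih =>
    rw [show 2 * (m + 1) + 1 = 2 * m + 1 + 1 + 1 by ring, Finset.sum_range_succ,
      Finset.sum_range_succ, ih, Finset.sum_range_succ (fun l => F (2 * l)) (m + 1),
      Finset.sum_range_succ (fun l => F (2 * l + 1)) m, show 2 * (m + 1) = 2 * m + 1 + 1 by ring]
    ring

/-- The two-point inequality behind hypercontractivity: only the even powers of `b` survive on the
left, and their binomial coefficients are compared with those on the right. -/
lemma two_point_pow_le (m : ℕ) (a b : ℝ) :
    (a + b) ^ (2 * m) + (a - b) ^ (2 * m) ≤ 2 * (a ^ 2 + (2 * m - 1) * b ^ 2) ^ m := by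
  have h1 : (a + b) ^ (2 * m) + (a - b) ^ (2 * m) =
      2 * ∑ l ∈ Finset.range (m + 1), b ^ (2 * l) * a ^ (2 * m - 2 * l) * (2 * m).choose (2 * l) := by
    rw [add_comm a b, sub_eq_neg_add, add_pow, add_pow, ← Finset.sum_add_distrib,
      sum_range_two_mul_add_one, Finset.mul_sum]
    have h2 : ∀ l, (-b) ^ (2 * l + 1) = -b ^ (2 * l + 1) := fun l => Odd.neg_pow ⟨l, rfl⟩ b
    have h3 : ∀ l, (-b) ^ (2 * l) = b ^ (2 * l) := fun l => Even.neg_pow ⟨l, by ring⟩ b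
    simp only [h2, h3]
    rw [Finset.sum_eq_zero (s := Finset.range m) fun l _ => by ring, add_zero]
    exact Finset.sum_congr rfl fun l _ => by ring
  rw [h1, add_comm (a ^ 2), add_pow]
  refine mul_le_mul_of_nonneg_left (Finset.sum_le_sum fun l hl => ?_) zero_le_two
  have h4 : a ^ (2 * m - 2 * l) = (a ^ 2) ^ (m - l) := by rw [← pow_mul, Nat.mul_sub]
  rw [h4, pow_mul, mul_pow]
  have h5 := choose_two_mul_le m l
  calc (b ^ 2) ^ l * (a ^ 2) ^ (m - l) * ((2 * m).choose (2 * l) : ℝ)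
      ≤ (b ^ 2) ^ l * (a ^ 2) ^ (m - l) * ((2 * m - 1 : ℝ) ^ l * (m.choose l : ℝ)) := by gcongr
    _ = _ := by ring

/-- Minkowski's inequality in `L^m` of the cube, for nonnegative functions and with the norms
replaced by upper bounds, which keeps the exponents integral. -/
lemma cubeExp_add_pow_le {n m : ℕ} (hm : m ≠ 0) {u v : Cube n → ℝ} (hu : ∀ x, 0 ≤ u x)
    (hv : ∀ x, 0 ≤ v x) {a b : ℝ} (ha : 0 ≤ a) (hb : 0 ≤ b)
    (hua : cubeExp (fun x => u x ^ m) ≤ a ^ m) (hvb : cubeExp (fun x => v x ^ m) ≤ b ^ m) :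
    cubeExp (fun x => (u x + v x) ^ m) ≤ (a + b) ^ m := by
  have hzero : ∀ w : Cube n → ℝ, (∀ x, 0 ≤ w x) → cubeExp (fun x => w x ^ m) ≤ (0 : ℝ) ^ m →
      ∀ x, w x = 0 := by
    intro w hw h x
    rw [zero_pow hm] at h
    have h1 := eq_zero_of_cubeExp_eq_zero (fun x => pow_nonneg (hw x) m)
      (le_antisymm h (cubeExp_nonneg fun x => pow_nonneg (hw x) m)) x
    exact (pow_eq_zero_iff hm).1 h1
  rcases ha.eq_or_lt with rfl | ha
  · simpa [hzero u hu hua] using hvb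
  rcases hb.eq_or_lt with rfl | hb
  · simpa [hzero v hv hvb] using hua
  have hab : 0 < a + b := by positivity
  -- convexity of `t ^ m`, with weights `a / (a + b)` and `b / (a + b)`
  have hpt : ∀ x, (u x + v x) ^ m ≤
      (a + b) ^ m * (a / (a + b) / a ^ m) * u x ^ m +
        (a + b) ^ m * (b / (a + b) / b ^ m) * v x ^ m := by
    intro x
    have hc := (convexOn_pow m).2 (Set.mem_Ici.2 (div_nonneg (hu x) ha.le))
      (Set.mem_Ici.2 (div_nonneg (hv x) hb.le)) (div_nonneg ha.le hab.le) (div_nonneg hb.le hab.le)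
      (by field_simp)
    simp only [smul_eq_mul] at hc
    have e : a / (a + b) * (u x / a) + b / (a + b) * (v x / b) = (u x + v x) / (a + b) := by
      field_simp
    rw [e, div_pow, div_pow, div_pow, div_le_iff₀ (by positivity)] at hc
    refine hc.trans (le_of_eq ?_)
    ring
  refine (cubeExp_mono hpt).trans ?_
  rw [cubeExp_add, cubeExp_const_mul, cubeExp_const_mul]
  calc _ ≤ (a + b) ^ m * (a / (a + b) / a ^ m) * a ^ m +
        (a + b) ^ m * (b / (a + b) / b ^ m) * b ^ m := by gcongr
    _ = (a + b) ^ m := by field_simp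

/-- The Bonami–Beckner inequality for the exponents `2` and `2m`, in polynomial form. -/
lemma cubeExp_walshSum_pow_le {n m : ℕ} (hm : m ≠ 0) (V : Finset (Fin n))
    (a : Finset (Fin n) → ℝ) :
    cubeExp (fun x => (∑ S ∈ V.powerset, a S * walsh S x) ^ (2 * m)) ≤
      (∑ S ∈ V.powerset, (2 * m - 1 : ℝ) ^ S.card * a S ^ 2) ^ m := by
  have hm1 : (1 : ℝ) ≤ m := by exact_mod_cast Nat.one_le_iff_ne_zero.2 hm
  have hc : (0 : ℝ) ≤ 2 * m - 1 := by linarith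
  induction V using Finset.induction_on generalizing a with
  | empty => simp [walsh_empty, cubeExp_const, pow_mul]
  | insert j V hj ih =>
    set c : ℝ := 2 * m - 1
    set g : Cube n → ℝ := fun x => ∑ S ∈ V.powerset, a S * walsh S x with hg
    set h : Cube n → ℝ := fun x => ∑ S ∈ V.powerset, a (insert j S) * walsh S x with hh
    have hjS : ∀ S ∈ V.powerset, j ∉ S := fun S hS hjS => hj (Finset.mem_powerset.1 hS hjS)
    have hf : ∀ x, ∑ S ∈ (insert j V).powerset, a S * walsh S x = g x + walsh {j} x * h x := by
      intro x
      rw [Finset.sum_powerset_insert hj]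
      congr 1
      rw [hh, Finset.mul_sum]
      refine Finset.sum_congr rfl fun S hS => ?_
      rw [walsh_insert (hjS S hS)]
      ring
    have hgf : ∀ x, g (flipBit j x) = g x := fun x =>
      Finset.sum_congr rfl fun S hS => by rw [walsh_flipBit_of_notMem (hjS S hS)]
    have hhf : ∀ x, h (flipBit j x) = h x := fun x =>
      Finset.sum_congr rfl fun S hS => by rw [walsh_flipBit_of_notMem (hjS S hS)]
    -- average over the `j`-th coordinate
    have havg : cubeExp (fun x => (g x + walsh {j} x * h x) ^ (2 * m)) ≤
        cubeExp (fun x => (g x ^ 2 + c * h x ^ 2) ^ m) := by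
      have h1 := cubeExp_comp_flipBit j (fun x => (g x + walsh {j} x * h x) ^ (2 * m))
      simp only [hgf, hhf, walsh_flipBit_of_mem (Finset.mem_singleton_self j)] at h1
      have h2 := cubeExp_mono (fun x => two_point_pow_le m (g x) (walsh {j} x * h x))
      have h3 : ∀ x, (walsh {j} x * h x) ^ 2 = h x ^ 2 := fun x => by
        rw [mul_pow, pow_two, walsh_mul_self, one_mul]
      simp only [h3, sub_eq_add_neg (g _), ← neg_mul] at h2
      rw [cubeExp_add, cubeExp_const_mul, h1] at h2
      linarith
    simp only [hf]
    refine havg.trans ?_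
    rw [Finset.sum_powerset_insert hj]
    have hpow : ∀ S : Finset (Fin n), 0 ≤ c ^ S.card := fun S => pow_nonneg hc _
    refine cubeExp_add_pow_le hm (fun x => sq_nonneg _) (fun x => mul_nonneg hc (sq_nonneg _))
      (Finset.sum_nonneg fun S _ => mul_nonneg (hpow _) (sq_nonneg _))
      (Finset.sum_nonneg fun S _ => mul_nonneg (hpow _) (sq_nonneg _)) ?_ ?_
    · simpa only [← pow_mul] using ih a
    · have h4 : ∑ S ∈ V.powerset, c ^ (insert j S).card * a (insert j S) ^ 2 =
          c * ∑ S ∈ V.powerset, c ^ S.card * a (insert j S) ^ 2 := by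
        rw [Finset.mul_sum]
        refine Finset.sum_congr rfl fun S hS => ?_
        rw [Finset.card_insert_of_notMem (hjS S hS)]
        ring
      simp only [h4, mul_pow, ← pow_mul, cubeExp_const_mul]
      exact mul_le_mul_of_nonneg_left (ih fun S => a (insert j S)) (pow_nonneg hc m)

/-- Hypercontractivity for a homogeneous Walsh polynomial of degree `d`. -/
lemma cubeExp_walshSum_powersetCard_pow_le {n m : ℕ} (hm : m ≠ 0) (d : ℕ) (V : Finset (Fin n))
    (a : Finset (Fin n) → ℝ) :
    cubeExp (fun x => (∑ S ∈ V.powersetCard d, a S * walsh S x) ^ (2 * m)) ≤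
      ((2 * m - 1 : ℝ) ^ d * ∑ S ∈ V.powersetCard d, a S ^ 2) ^ m := by
  have h := cubeExp_walshSum_pow_le hm V (fun S => if S.card = d then a S else 0)
  simp only [ite_mul, zero_mul, ite_pow, mul_ite, ne_eq, OfNat.ofNat_ne_zero, not_false_eq_true,
    zero_pow, mul_zero, ← Finset.sum_filter, ← Finset.powersetCard_eq_filter] at h
  refine h.trans (le_of_eq ?_)
  congr 1
  rw [Finset.mul_sum]
  exact Finset.sum_congr rfl fun S hS => by rw [(Finset.mem_powersetCard.1 hS).2]

/-! ### The level inequality for vector-valued functions -/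

/-- A bound `w` on the square of the `L^{2(m+1)}` norm of `L` makes its tail above the level
`√(e w)` exponentially small in `m`. -/
lemma cubeExp_sq_tail_le {n m : ℕ} {L : Cube n → ℝ} {w : ℝ} (hw : 0 ≤ w)
    (hL : cubeExp (fun x => L x ^ (2 * (m + 1))) ≤ w ^ (m + 1)) :
    cubeExp (fun x => (if L x ^ 2 ≤ Real.exp 1 * w then 0 else |L x|) ^ 2) ≤
      w * Real.exp (-m) := by
  rcases hw.eq_or_lt with rfl | hw
  · have h0 : ∀ x, L x ^ (2 * (m + 1)) = 0 := by
      have hnn : ∀ x, 0 ≤ L x ^ (2 * (m + 1)) := fun x => by rw [pow_mul]; positivity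
      refine eq_zero_of_cubeExp_eq_zero hnn (le_antisymm ?_ (cubeExp_nonneg hnn))
      simpa using hL
    have h1 : ∀ x, L x = 0 := fun x => by simpa using h0 x
    simp [h1, cubeExp_const]
  · have hE : 0 < Real.exp 1 * w := by positivity
    have hpt : ∀ x, (if L x ^ 2 ≤ Real.exp 1 * w then 0 else |L x|) ^ 2 ≤
        ((Real.exp 1 * w) ^ m)⁻¹ * L x ^ (2 * (m + 1)) := by
      intro x
      split_ifs with h
      · rw [zero_pow two_ne_zero, pow_mul]
        positivity
      · push Not at h
        rw [sq_abs, pow_mul, pow_succ (L x ^ 2), ← mul_assoc]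
        refine le_mul_of_one_le_left (sq_nonneg _) ?_
        rw [inv_mul_eq_div, one_le_div (by positivity)]
        gcongr
    refine (cubeExp_mono hpt).trans ?_
    rw [cubeExp_const_mul]
    calc ((Real.exp 1 * w) ^ m)⁻¹ * cubeExp (fun x => L x ^ (2 * (m + 1)))
        ≤ ((Real.exp 1 * w) ^ m)⁻¹ * w ^ (m + 1) := by gcongr
      _ = w * Real.exp (-m) := by
        rw [mul_pow, ← Real.exp_nat_mul, mul_one, Real.exp_neg, pow_succ]
        field_simp

/-- Cauchy–Schwarz in `L²(cube; ℓ²)`. -/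
lemma sq_sum_cubeExp_mul_le {n : ℕ} {ι : Type*} (s : Finset ι) (u v : ι → Cube n → ℝ) :
    (∑ i ∈ s, cubeExp fun x => u i x * v i x) ^ 2 ≤
      (cubeExp fun x => ∑ i ∈ s, u i x ^ 2) * ∑ i ∈ s, cubeExp fun x => v i x ^ 2 := by
  have h := Finset.sum_mul_sq_le_sq_mul_sq (s ×ˢ (Finset.univ : Finset (Cube n)))
    (fun p => u p.1 p.2) (fun p => v p.1 p.2)
  simp only [Finset.sum_product] at h
  rw [cubeExp_sum]
  simp only [cubeExp, ← Finset.sum_div]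
  rw [div_pow, div_mul_div_comm, ← pow_two]
  gcongr

/-- If `H : cube → ℓ²` takes values in the unit ball, then its Fourier weight at level `d` is
controlled by the vector of `L¹` norms of its coordinates, up to a factor `O(m)^d` which is
logarithmic in the size of that vector. Pairing `H` with its own level-`d` part `L`, the part
where `L_i` is of the order of its standard deviation sees only the `L¹` norms, and the rest of
`L` is negligible by hypercontractivity. -/
lemma sum_sq_fourierWalsh_level_le {n : ℕ} {ι : Type*} (s : Finset ι) (V : Finset (Fin n))
    (d m : ℕ) (H : ι → Cube n → ℝ) {δ : ℝ} (hH : ∀ x, ∑ i ∈ s, H i x ^ 2 ≤ 1)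
    (hδ : Real.exp (-m) ≤ δ) (hI : ∑ i ∈ s, (cubeExp fun x => |H i x|) ^ 2 ≤ δ / 4) :
    ∑ i ∈ s, ∑ T ∈ V.powersetCard d, fourierWalsh (H i) T ^ 2 ≤ 4 * (2 * m + 1) ^ d * δ := by
  set D : ℝ := (2 * m + 1) ^ d with hD
  have hD0 : 0 < D := by positivity
  have hδ0 : 0 < δ := (Real.exp_pos _).trans_le hδ
  set v : ι → ℝ := fun i => ∑ T ∈ V.powersetCard d, fourierWalsh (H i) T ^ 2 with hv
  have hv0 : ∀ i, 0 ≤ v i := fun i => Finset.sum_nonneg fun T _ => sq_nonneg _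
  set L : ι → Cube n → ℝ := fun i x =>
    ∑ T ∈ V.powersetCard d, fourierWalsh (H i) T * walsh T x with hLdef
  have hL : ∀ i, cubeExp (fun x => L i x ^ (2 * (m + 1))) ≤ (D * v i) ^ (m + 1) := by
    intro i
    have h := cubeExp_walshSum_powersetCard_pow_le (Nat.succ_ne_zero m) d V (fourierWalsh (H i))
    have e : (2 * ((m + 1 : ℕ) : ℝ) - 1) = 2 * m + 1 := by push_cast; ring
    rwa [Nat.succ_eq_add_one, e] at h
  set q : ι → Cube n → ℝ := fun i x =>
    if L i x ^ 2 ≤ Real.exp 1 * (D * v i) then 0 else |L i x| with hq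
  have hqle : ∀ i, cubeExp (fun x => q i x ^ 2) ≤ D * v i * δ := fun i =>
    (cubeExp_sq_tail_le (mul_nonneg hD0.le (hv0 i)) (hL i)).trans
      (mul_le_mul_of_nonneg_left hδ (mul_nonneg hD0.le (hv0 i)))
  set t : ι → ℝ := fun i => Real.sqrt (Real.exp 1 * (D * v i)) with ht
  have ht2 : ∀ i, t i ^ 2 = Real.exp 1 * (D * v i) := fun i =>
    Real.sq_sqrt (mul_nonneg (Real.exp_pos 1).le (mul_nonneg hD0.le (hv0 i)))
  have ht0 : ∀ i, 0 ≤ t i := fun i => Real.sqrt_nonneg _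
  have hLq : ∀ i x, |L i x| ≤ t i + q i x := by
    intro i x
    by_cases h : L i x ^ 2 ≤ Real.exp 1 * (D * v i)
    · simp only [hq, h, if_true, add_zero]
      exact Real.abs_le_sqrt h
    · simp only [hq, h, if_false]
      linarith [ht0 i]
  have hvL : ∀ i, v i = cubeExp fun x => H i x * L i x := by
    intro i
    simp only [hLdef, Finset.mul_sum, cubeExp_sum, hv]
    refine Finset.sum_congr rfl fun T _ => ?_
    rw [pow_two]
    conv_lhs => rw [← show cubeExp (fun x => fourierWalsh (H i) T * (H i x * walsh T x)) =
      fourierWalsh (H i) T * fourierWalsh (H i) T from cubeExp_const_mul _ _]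
    congr 1
    funext x
    ring
  set A : ℝ := ∑ i ∈ s, (cubeExp fun x => |H i x|) * t i with hA
  set B : ℝ := ∑ i ∈ s, cubeExp fun x => |H i x| * q i x with hB
  have hAB : ∑ i ∈ s, v i ≤ A + B := by
    rw [hA, hB, ← Finset.sum_add_distrib]
    refine Finset.sum_le_sum fun i _ => ?_
    rw [hvL i, mul_comm _ (t i), ← cubeExp_const_mul, ← cubeExp_add]
    refine cubeExp_mono fun x => ?_
    calc H i x * L i x ≤ |H i x| * |L i x| := by rw [← abs_mul]; exact le_abs_self _
      _ ≤ |H i x| * (t i + q i x) := by gcongr; exact hLq i x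
      _ = _ := by ring
  have hA2 : A ^ 2 ≤ δ / 4 * (Real.exp 1 * (D * ∑ i ∈ s, v i)) := by
    refine (Finset.sum_mul_sq_le_sq_mul_sq s _ _).trans ?_
    simp only [ht2, ← Finset.mul_sum]
    gcongr
  have hB2 : B ^ 2 ≤ D * (∑ i ∈ s, v i) * δ := by
    refine (sq_sum_cubeExp_mul_le s _ _).trans ?_
    have h1 : (cubeExp fun x => ∑ i ∈ s, |H i x| ^ 2) ≤ 1 := by
      simp only [sq_abs]
      exact (cubeExp_mono hH).trans (cubeExp_const 1).le
    have h2 : ∑ i ∈ s, cubeExp (fun x => q i x ^ 2) ≤ D * (∑ i ∈ s, v i) * δ := by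
      rw [Finset.mul_sum, Finset.sum_mul]
      exact Finset.sum_le_sum fun i _ => hqle i
    have h3 : 0 ≤ ∑ i ∈ s, cubeExp (fun x => q i x ^ 2) :=
      Finset.sum_nonneg fun i _ => cubeExp_nonneg fun x => sq_nonneg _
    exact (mul_le_of_le_one_left h3 h1).trans h2
  set W : ℝ := ∑ i ∈ s, v i with hW
  have hW0 : 0 ≤ W := Finset.sum_nonneg fun i _ => hv0 i
  have he : Real.exp 1 ≤ 4 := by linarith [Real.exp_one_lt_d9]
  have hA3 : A ^ 2 ≤ δ * D * W := by
    refine hA2.trans ?_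
    have : 0 ≤ δ * D * W := by positivity
    nlinarith
  have hfin : W * W ≤ 4 * D * δ * W := by
    have h1 : W * W ≤ (A + B) ^ 2 := by rw [pow_two]; exact mul_self_le_mul_self hW0 hAB
    nlinarith [sq_nonneg (A - B)]
  rcases hW0.eq_or_lt with h | h
  · rw [← h]
    positivity
  · exact le_of_mul_le_mul_right hfin h

/-! ### Splitting the coordinates -/

/-- For `j ∉ J`, the `{j}`-th coefficient of the restriction of `f` obtained by fixing the
coordinates in `J` is a function of these coordinates whose own coefficients are those of `f`. -/
lemma fourierWalsh_fourierWalsh_piecewise {n : ℕ} (f : Cube n → ℝ) {J T : Finset (Fin n)}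
    {j : Fin n} (hj : j ∉ J) (hT : T ⊆ J) :
    fourierWalsh (fun x => fourierWalsh (fun z => f (J.piecewise x z)) {j}) T =
      fourierWalsh f (insert j T) := by
  rw [fourierWalsh, fourierWalsh,
    ← cubeExp_cubeExp_piecewise J (fun y => f y * walsh (insert j T) y)]
  congr 1
  funext x
  rw [fourierWalsh, mul_comm, ← cubeExp_const_mul]
  congr 1
  funext z
  rw [walsh_insert (fun h => hj (hT h))]
  have h1 : walsh {j} (J.piecewise x z) = walsh {j} z :=
    walsh_congr fun i hi => by rw [Finset.mem_singleton.1 hi, Finset.piecewise_eq_of_notMem _ _ _ hj]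
  have h2 : walsh T (J.piecewise x z) = walsh T x :=
    walsh_congr fun i hi => Finset.piecewise_eq_of_mem _ _ _ (hT hi)
  rw [h1, h2]
  ring

/-- The coefficients of `f` at sets with exactly one element outside `J` are those of the
first-order coefficients of the restrictions of `f`, to which the vector-valued level inequality
applies. -/
lemma sum_fourierWalsh_insert_sq_le {n : ℕ} {f : Cube n → ℝ} (hf : Monotone f)
    (hf1 : ∀ x, f x ^ 2 ≤ 1) (J : Finset (Fin n)) (d m : ℕ)
    (hm : Real.exp (-m) ≤ sumSqInfluence f) :
    ∑ j ∈ Jᶜ, ∑ T ∈ J.powersetCard d, fourierWalsh f (insert j T) ^ 2 ≤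
      4 * (2 * m + 1) ^ d * sumSqInfluence f := by
  set H : Fin n → Cube n → ℝ := fun j x => fourierWalsh (fun z => f (J.piecewise x z)) {j} with hH
  have hmono : ∀ x, Monotone fun z => f (J.piecewise x z) := fun x z z' h =>
    hf fun i => by
      by_cases hi : i ∈ J
      · simp [hi]
      · simpa [hi] using h i
  have hneg : ∀ j x, H j x ≤ 0 := by
    intro j x
    simp only [hH]
    rw [fourierWalsh_singleton_of_monotone (hmono x)]
    linarith [influence_nonneg (fun z => f (J.piecewise x z)) j]
  have hball : ∀ x, ∑ j ∈ Jᶜ, H j x ^ 2 ≤ 1 := by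
    intro x
    calc ∑ j ∈ Jᶜ, H j x ^ 2 ≤ ∑ j, H j x ^ 2 :=
          Finset.sum_le_sum_of_subset_of_nonneg (Finset.subset_univ _) fun _ _ _ => sq_nonneg _
      _ ≤ cubeExp fun z => f (J.piecewise x z) ^ 2 := by
          rw [← sum_powersetCard_one
            (fun S => fourierWalsh (fun z => f (J.piecewise x z)) S ^ 2)]
          exact sum_fourierWalsh_sq_le _ _
      _ ≤ 1 := (cubeExp_mono fun z => hf1 _).trans (cubeExp_const 1).le
  -- monotonicity identifies the `L¹` norm of `H j` with (half) the influence of `j` on `f`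
  have habs : ∀ j ∈ Jᶜ, (cubeExp fun x => |H j x|) = influence f j / 2 := by
    intro j hj
    have h1 := fourierWalsh_fourierWalsh_piecewise f (Finset.mem_compl.1 hj) (Finset.empty_subset J)
    rw [insert_empty_eq, fourierWalsh_singleton_of_monotone hf] at h1
    have h2 : cubeExp (H j) = -influence f j / 2 := by
      rw [← h1, fourierWalsh]
      simp only [walsh_empty, mul_one, hH]
    simp only [abs_of_nonpos (hneg j _), cubeExp_neg]
    rw [h2]
    ring
  have hI : ∑ j ∈ Jᶜ, (cubeExp fun x => |H j x|) ^ 2 ≤ sumSqInfluence f / 4 := by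
    rw [Finset.sum_congr rfl fun j hj => by rw [habs j hj], sumSqInfluence, Finset.sum_div]
    refine (Finset.sum_le_sum_of_subset_of_nonneg (Finset.subset_univ _)
      fun _ _ _ => sq_nonneg _).trans (Finset.sum_le_sum fun j _ => le_of_eq ?_)
    ring
  refine (Finset.sum_le_sum fun j hj => Finset.sum_le_sum fun T hT => le_of_eq ?_).trans
    (sum_sq_fourierWalsh_level_le Jᶜ J d m H hball hm hI)
  rw [fourierWalsh_fourierWalsh_piecewise f (Finset.mem_compl.1 hj)
    (Finset.mem_powersetCard.1 hT).1]

/-- The sets `insert j T` with `j ∉ J` and `T ⊆ J` of size `d` are distinct, and they are the sets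
of size `d + 1` with exactly one element outside `J`. -/
lemma sum_filter_card_sdiff_le {n : ℕ} (d : ℕ) (J : Finset (Fin n)) (F : Finset (Fin n) → ℝ)
    (hF : ∀ S, 0 ≤ F S) :
    ∑ S ∈ (Finset.univ : Finset (Fin n)).powersetCard (d + 1) with (S \ J).card = 1, F S ≤
      ∑ j ∈ Jᶜ, ∑ T ∈ J.powersetCard d, F (insert j T) := by
  rw [← Finset.sum_product']
  have hinj : Set.InjOn (fun p : Fin n × Finset (Fin n) => insert p.1 p.2)
      (Jᶜ ×ˢ J.powersetCard d : Finset (Fin n × Finset (Fin n))) := by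
    rintro ⟨j, T⟩ h1 ⟨j', T'⟩ h2 h
    simp only [Finset.coe_product, Set.mem_prod, Finset.mem_coe, Finset.mem_compl,
      Finset.mem_powersetCard] at h1 h2 h
    have hjj : j = j' := by
      have : j ∈ insert j' T' := h ▸ Finset.mem_insert_self j T
      rcases Finset.mem_insert.1 this with h3 | h3
      · exact h3
      · exact absurd (h2.2.1 h3) h1.1
    subst hjj
    have e1 := Finset.erase_insert (fun h3 => h1.1 (h1.2.1 h3))
    have e2 := Finset.erase_insert (fun h3 => h2.1 (h2.2.1 h3))
    rw [← e1, ← e2, h]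
  rw [← Finset.sum_image (f := F) hinj]
  refine Finset.sum_le_sum_of_subset_of_nonneg ?_ fun S _ _ => hF S
  intro S hS
  simp only [Finset.mem_filter, Finset.mem_powersetCard] at hS
  obtain ⟨j, hj⟩ := Finset.card_eq_one.1 hS.2
  have hjS : j ∈ S \ J := hj ▸ Finset.mem_singleton_self j
  rw [Finset.mem_sdiff] at hjS
  simp only [Finset.mem_image, Finset.mem_product, Finset.mem_compl, Finset.mem_powersetCard,
    Prod.exists]
  refine ⟨j, S.erase j, ⟨hjS.2, fun i hi => ?_, ?_⟩, Finset.insert_erase hjS.1⟩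
  · by_contra hiJ
    have : i ∈ S \ J := Finset.mem_sdiff.2 ⟨Finset.mem_of_mem_erase hi, hiJ⟩
    rw [hj, Finset.mem_singleton] at this
    exact Finset.ne_of_mem_erase hi this
  · rw [Finset.card_erase_of_mem hjS.1]
    omega

/-- At least a `2^{-|S|}` proportion of all `J` leave out exactly one element of `S`: fix `j ∈ S`
and take `J = (S \ {j}) ∪ U` with `U` disjoint from `S`. -/
lemma two_pow_le_card_filter_sdiff {n : ℕ} {S : Finset (Fin n)} (hS : S.Nonempty) :
    2 ^ n ≤ 2 ^ S.card * (Finset.univ.filter fun J : Finset (Fin n) => (S \ J).card = 1).card := by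
  obtain ⟨j, hj⟩ := hS
  have h1 : Sᶜ.powerset.card ≤
      (Finset.univ.filter fun J : Finset (Fin n) => (S \ J).card = 1).card := by
    refine Finset.card_le_card_of_injOn (fun U => S.erase j ∪ U) ?_ ?_
    · intro U hU
      rw [Finset.mem_coe, Finset.mem_powerset] at hU
      simp only [Finset.coe_filter, Finset.mem_univ, true_and, Set.mem_ofPred_eq]
      rw [Finset.card_eq_one]
      refine ⟨j, ?_⟩
      ext i
      have := fun h : i ∈ U => Finset.mem_compl.1 (hU h)
      simp only [Finset.mem_sdiff, Finset.mem_union, Finset.mem_erase, Finset.mem_singleton]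
      constructor
      · rintro ⟨h2, h3⟩
        by_contra h4
        exact h3 (Or.inl ⟨h4, h2⟩)
      · rintro rfl
        exact ⟨hj, by tauto⟩
    · intro U hU U' hU' h
      rw [Finset.mem_coe, Finset.mem_powerset] at hU hU'
      ext i
      have h2 := congrArg (fun X => i ∈ X) h
      have h3 := fun h : i ∈ U => Finset.mem_compl.1 (hU h)
      have h4 := fun h : i ∈ U' => Finset.mem_compl.1 (hU' h)
      simp only [Finset.mem_union, Finset.mem_erase, eq_iff_iff] at h2
      tauto
  rw [Finset.card_powerset, Finset.card_compl, Fintype.card_fin] at h1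
  have hle : S.card ≤ n := by simpa using Finset.card_le_univ S
  calc 2 ^ n = 2 ^ S.card * 2 ^ (n - S.card) := by rw [← pow_add]; congr 1; omega
    _ ≤ _ := Nat.mul_le_mul_left _ h1

lemma levelWeight_succ_le_of_forall {n d : ℕ} {f : Cube n → ℝ} {B : ℝ}
    (hB : ∀ J : Finset (Fin n),
      ∑ j ∈ Jᶜ, ∑ T ∈ J.powersetCard d, fourierWalsh f (insert j T) ^ 2 ≤ B) :
    levelWeight (d + 1) f ≤ 2 ^ (d + 1) * B := by
  have h1 : ∑ J : Finset (Fin n),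
      ∑ S ∈ (Finset.univ : Finset (Fin n)).powersetCard (d + 1) with (S \ J).card = 1,
        fourierWalsh f S ^ 2 ≤ 2 ^ n * B := by
    refine (Finset.sum_le_card_nsmul _ _ B fun J _ => ?_).trans (le_of_eq (by simp))
    exact (sum_filter_card_sdiff_le d J _ fun S => sq_nonneg _).trans (hB J)
  have h2 : 2 ^ n * levelWeight (d + 1) f ≤ 2 ^ (d + 1) * ∑ J : Finset (Fin n),
      ∑ S ∈ (Finset.univ : Finset (Fin n)).powersetCard (d + 1) with (S \ J).card = 1,
        fourierWalsh f S ^ 2 := by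
    simp only [Finset.sum_filter]
    rw [Finset.sum_comm, levelWeight, Finset.mul_sum, Finset.mul_sum]
    refine Finset.sum_le_sum fun S hS => ?_
    rw [Finset.mem_powersetCard] at hS
    have hne : S.Nonempty := by
      rw [← Finset.card_pos]
      omega
    have h3 := two_pow_le_card_filter_sdiff hne
    rw [hS.2] at h3
    have h4 : (2 : ℝ) ^ n ≤ 2 ^ (d + 1) *
        (Finset.univ.filter fun J : Finset (Fin n) => (S \ J).card = 1).card := by
      exact_mod_cast h3
    rw [← Finset.sum_filter, Finset.sum_const, nsmul_eq_mul, ← mul_assoc]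
    gcongr
  have h5 : (0 : ℝ) < 2 ^ n := by positivity
  refine le_of_mul_le_mul_left ?_ h5
  calc _ ≤ _ := h2
    _ ≤ 2 ^ (d + 1) * (2 ^ n * B) := by gcongr
    _ = _ := by ring

/-! ### Events -/

lemma eventInd_sq {n : ℕ} (A : Set (Cube n)) (x : Cube n) : eventInd A x ^ 2 = eventInd A x := by
  by_cases h : x ∈ A <;> simp [eventInd, h]

lemma eventInd_sq_le_one {n : ℕ} (A : Set (Cube n)) (x : Cube n) : eventInd A x ^ 2 ≤ 1 := by
  by_cases h : x ∈ A <;> simp [eventInd, h]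

/-- The weights of levels one and two add up to at most the variance of the indicator. -/
lemma levelWeight_one_add_two_le {n : ℕ} (A : Set (Cube n)) :
    levelWeight 1 (eventInd A) + levelWeight 2 (eventInd A) ≤ 1 / 4 := by
  classical
  set U : Finset (Fin n) := Finset.univ
  have hd : ∀ a b, a ≠ b → Disjoint (U.powersetCard a) (U.powersetCard b) := fun a b h =>
    Finset.pairwise_disjoint_powersetCard U h
  have h := sum_fourierWalsh_sq_le
    (U.powersetCard 0 ∪ (U.powersetCard 1 ∪ U.powersetCard 2)) (eventInd A)
  rw [Finset.sum_union, Finset.sum_union (hd 1 2 (by norm_num)), Finset.powersetCard_zero,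
    Finset.sum_singleton] at h
  · simp only [eventInd_sq] at h
    have h0 : fourierWalsh (eventInd A) ∅ = cubeExp (eventInd A) := by
      simp [fourierWalsh, walsh_empty]
    rw [h0] at h
    have h1 : cubeExp (fun x => eventInd A x) = cubeExp (eventInd A) := rfl
    rw [h1] at h
    simp only [levelWeight]
    nlinarith [sq_nonneg (cubeExp (eventInd A) - 1 / 2)]
  · rw [Finset.disjoint_union_right]
    exact ⟨hd 0 1 (by norm_num), hd 0 2 (by norm_num)⟩

lemma levelWeight_nonneg {n : ℕ} (k : ℕ) (f : Cube n → ℝ) : 0 ≤ levelWeight k f :=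
  Finset.sum_nonneg fun _ _ => sq_nonneg _

lemma levelWeight_two_le {n : ℕ} {A : Set (Cube n)} (hA : MonotoneEvent A) :
    levelWeight 2 (eventInd A) ≤ (1 - sumSqInfluence (eventInd A)) / 4 := by
  have h := levelWeight_one_add_two_le A
  rw [levelWeight_one_of_monotone hA] at h
  linarith

lemma sumSqInfluence_le_one {n : ℕ} {A : Set (Cube n)} (hA : MonotoneEvent A) :
    sumSqInfluence (eventInd A) ≤ 1 := by
  linarith [levelWeight_two_le hA, levelWeight_nonneg 2 (eventInd A)]

lemma levelWeight_succ_le {n d : ℕ} {A : Set (Cube n)} (hA : MonotoneEvent A)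
    (h0 : 0 < sumSqInfluence (eventInd A)) :
    levelWeight (d + 1) (eventInd A) ≤ 2 ^ (d + 1) * (4 * 3 ^ d) * sumSqInfluence (eventInd A) *
      (1 - Real.log (sumSqInfluence (eventInd A))) ^ d := by
  have h1 := sumSqInfluence_le_one hA
  set I := sumSqInfluence (eventInd A) with hI
  have hlog : Real.log I ≤ 0 := Real.log_nonpos h0.le h1
  -- the exponent of the moment: the least `m` with `e^{-m} ≤ I`
  set m : ℕ := ⌈-Real.log I⌉₊
  have hm : Real.exp (-m) ≤ I := by
    rw [← Real.le_log_iff_exp_le h0]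
    linarith [Nat.le_ceil (-Real.log I)]
  have hm2 : (2 * m + 1 : ℝ) ≤ 3 * (1 - Real.log I) := by
    linarith [Nat.ceil_lt_add_one (neg_nonneg.2 hlog)]
  refine (levelWeight_succ_le_of_forall fun J =>
    sum_fourierWalsh_insert_sq_le hA (eventInd_sq_le_one A) J d m hm).trans ?_
  calc 2 ^ (d + 1) * (4 * (2 * m + 1 : ℝ) ^ d * I)
      ≤ 2 ^ (d + 1) * (4 * (3 * (1 - Real.log I)) ^ d * I) := by gcongr
    _ = _ := by rw [mul_pow]; ring

end

theorem theoremt (k : ℕ) (hk : 1 ≤ k) :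
    ∃ C : ℝ, ∀ (n : ℕ) (A : Set (Cube n)), MonotoneEvent A →
      levelWeight k (eventInd A) ≤
          C * sumSqInfluence (eventInd A) *
            (1 - Real.log (sumSqInfluence (eventInd A))) ^ (k - 1) ∧
      ((k ≤ 2 ∨ sumSqInfluence (eventInd A) ≤ 1 / 2) →
        levelWeight k (eventInd A) ≤
          C * sumSqInfluence (eventInd A) *
            (-Real.log (sumSqInfluence (eventInd A))) ^ (k - 1)) := by
  obtain ⟨d, rfl⟩ := Nat.exists_eq_add_of_le' hk
  refine ⟨2 ^ (d + 1) * (4 * 3 ^ d) * 3 ^ d, fun n A hA => ?_⟩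
  rw [Nat.add_sub_cancel]
  rcases (sumSqInfluence_nonneg (eventInd A)).eq_or_lt with h0 | h0
  · have hW := levelWeight_eq_zero_of_sumSqInfluence_eq_zero hk h0.symm
    simp [hW, ← h0]
  have hmain := levelWeight_succ_le (d := d) hA h0
  have h1 := sumSqInfluence_le_one hA
  have hW2 := levelWeight_two_le hA
  set I := sumSqInfluence (eventInd A)
  have hlog : 0 ≤ -Real.log I := neg_nonneg.2 (Real.log_nonpos h0.le h1)
  have h3 : (1 : ℝ) ≤ 3 ^ d := one_le_pow₀ (by norm_num)
  refine ⟨hmain.trans ?_, fun hcase => ?_⟩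
  · have : 0 ≤ 1 - Real.log I := by linarith
    gcongr ?_ * I * (1 - Real.log I) ^ d
    exact le_mul_of_one_le_right (by positivity) h3
  by_cases hI : I ≤ 1 / 2
  · -- here `-log I ≥ log 2 > 1/2`, so that `1 - log I ≤ 3 (-log I)`
    have hlog2 : Real.log I ≤ -Real.log 2 := by
      rw [← Real.log_inv]
      exact Real.log_le_log h0 (by linarith)
    have hle : 1 - Real.log I ≤ 3 * -Real.log I := by linarith [Real.log_two_gt_d9]
    refine hmain.trans ?_
    calc 2 ^ (d + 1) * (4 * 3 ^ d) * I * (1 - Real.log I) ^ d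
        ≤ 2 ^ (d + 1) * (4 * 3 ^ d) * I * (3 * -Real.log I) ^ d := by
          have : 0 ≤ 1 - Real.log I := by linarith
          gcongr
      _ = _ := by rw [mul_pow]; ring
  · have hd : d ≤ 1 := by
      rcases hcase with h | h
      · omega
      · exact absurd h hI
    push Not at hI
    interval_cases d
    · simpa using hmain
    · -- the remaining variance `(1 - I) / 4` is at most `-log I / 4`
      have h4 := Real.log_le_sub_one_of_pos h0
      simp only [Nat.reduceAdd] at hW2 ⊢
      refine hW2.trans ?_
      rw [pow_one]
      nlinarith
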